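/- Let $K$ be a field. For $n\ge 1$ equip $\mathrm{GL}_n(K)$ with the rank length $\ell_{\mathrm r}(A)=\frac{\operatorname{rank}(1-A)}{n}$. A group $\Gamma$ is called $K$-sofic if there are constants $\delta_g>0$ ($g\in\Gamma\setminus\{1\}$) such that for every $\varepsilon>0$ and every finite subset $E\subset\Gamma$ there are $n\ge 1$ and a map $\phi\colon\Gamma\to \mathrm{GL}_n(K)$ with 1. $\ell_{\mathrm r}(\phi(1))\le\varepsilon$, 2. $\ell_{\mathrm r}(\phi(g))\ge\delta_g$ for all $g\in E\setminus\{1\}$, 3. $\ell_{\mathrm r}(\phi(g)\phi(h)\phi(gh)^{-1})\le\varepsilon$ for all $g,h\in E$. Then the class of $K$-sofic groups is closed under taking subgroups, inverse limits, direct products and direct limits. That is: - every subgroup of a $K$-sofic group is $K$-sofic; - if $(\Gamma_i)_{i\in I}$ is an inverse system of $K$-sofic groups over a directed set $I$, with homomorphisms $\pi_{ij}\colon\Gamma_j\to\Gamma_i$ for $i\le j$, then its inverse limit $\{(g_i)\in\prod_{i\in I}\Gamma_i : \pi_{ij}(g_j)=g_i \text{ for all } i\le j\}$ is $K$-sofic;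 - if $(\Gamma_i)_{i\in I}$ is an arbitrary family of $K$-sofic groups, then $\prod_{i\in I}\Gamma_i$ is $K$-sofic; - if $(\Gamma_i)_{i\in I}$ is a direct system of $K$-sofic groups over a nonempty directed set $I$, with arbitrary (not necessarily injective) connecting homomorphisms, then $\varinjlim\Gamma_i$ is $K$-sofic. -/

import Mathlib

/-- Let `(G i)` be a family (class) of groups, each equipped with a length function `ℓ i`.
A group `Γ` has the approximation property with respect to this class if there are constants
`δ g > 0` for `g ≠ 1` such that for every `ε > 0` and every finite `E ⊆ Γ` there is a map from `Γ`
to a group of the class which is an `(E, ε)`-homomorphism (relative to `δ`). -/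
def HasApproximationProperty {ι : Type*} (G : ι → Type*) [∀ i, Group (G i)] (ℓ : ∀ i, G i → ℝ)
    (Γ : Type*) [Group Γ] : Prop :=
  ∃ δ : Γ → ℝ, (∀ g, g ≠ 1 → 0 < δ g) ∧
    ∀ ε : ℝ, 0 < ε → ∀ E : Finset Γ, ∃ (i : ι) (φ : Γ → G i),
      ℓ i (φ 1) ≤ ε ∧
      (∀ g ∈ E, g ≠ 1 → δ g ≤ ℓ i (φ g)) ∧
      ∀ g ∈ E, ∀ h ∈ E, ℓ i (φ g * φ h * (φ (g * h))⁻¹) ≤ ε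

/-- The rank length `rank (1 - A) / n` of an invertible `n × n` matrix `A`. -/
noncomputable def rankLength {K : Type*} [Field K] {n : ℕ}
    (A : Matrix.GeneralLinearGroup (Fin n) K) : ℝ :=
  ((1 - (A : Matrix (Fin n) (Fin n) K)).rank : ℝ) / n

/-- A group is `K`-sofic if it has the approximation property with respect to the groups
`GL_n(K)`, `n ≥ 1`, with the rank length. -/
def IsSoficOver (K : Type*) [Field K] (Γ : Type*) [Group Γ] : Prop :=
  HasApproximationProperty (fun n : ℕ+ => Matrix.GeneralLinearGroup (Fin n) K)
    (fun _ A => rankLength A) Γ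

/-- The inverse limit of an inverse system of groups `π i j : Γ j → Γ i` (`i ≤ j`), as the subgroup
of compatible vectors in the direct product. -/
def inverseLimitSubgroup {ι : Type*} [Preorder ι] (Γ : ι → Type*) [∀ i, Group (Γ i)]
    (π : ∀ i j, i ≤ j → Γ j →* Γ i) : Subgroup (∀ i, Γ i) where
  carrier := {x | ∀ i j (h : i ≤ j), π i j h (x j) = x i}
  one_mem' := fun _ _ _ => map_one _
  mul_mem' := fun hx hy i j h => by
    simp only [Pi.mul_apply, map_mul, hx i j h, hy i j h]
  inv_mem' := fun hx i j h => by
    simp only [Pi.inv_apply, map_inv, hx i j h]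

/-! The constants `δ g` can all be replaced by `1 / 4`. The tool is a tensor-like action of `GL(V) ×
GL(W)` on `Hom(W, V)`: writing ℓ for relative rank of `1 - A`, it satisfies 1 - 2ℓ(A,B) ≤ (1 -
2ℓ(A))(1 - 2ℓ(B)) and ℓ(A,B) ≤ ℓ(A) + ℓ(B) (`exists_tensor_monoidHom`). Replacing `A` by `A ⊕ 1`
makes each factor equal to 1 - ℓ(A) ≥ 0, so high powers push ℓ up to nearly 1/2 while errors grow
only linearly (`exists_amplification_monoidHom`).

Direct sums combine finitely many separated elements, and amplification repairs the loss. Soficity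
can thus be tested one element at a time (`isSoficOver_iff_separatesWith_singleton`), so it passes
to any group whose points are separated by homomorphisms to sofic groups: subgroups, products and
inverse limits. For direct limits the uniform constant is essential, since the level used varies
with the finite set. -/

open Module

/-! ### Rank estimates for the action on `Hom(W, V)` -/

/-- The linear maps `W → V` that vanish on `q` and take values in `p`. -/
def LinearMap.boundedMaps {K V W : Type*} [Field K] [AddCommGroup V] [Module K V]
    [AddCommGroup W] [Module K W] (q : Submodule K W) (p : Submodule K V) :
    Submodule K (W →ₗ[K] V) where
  carrier := {Y | (∀ w ∈ q, Y w = 0) ∧ ∀ w, Y w ∈ p}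
  zero_mem' := ⟨fun _ _ => rfl, fun _ => p.zero_mem⟩
  add_mem' := fun ha hb => ⟨fun w hw => by simp [ha.1 w hw, hb.1 w hw],
    fun w => p.add_mem (ha.2 w) (hb.2 w)⟩
  smul_mem' := fun c _ ha => ⟨fun w hw => by simp [ha.1 w hw], fun w => p.smul_mem c (ha.2 w)⟩

theorem LinearMap.finrank_boundedMaps_le {K V W : Type*} [Field K] [AddCommGroup V] [Module K V]
    [AddCommGroup W] [Module K W] [FiniteDimensional K V] [FiniteDimensional K W]
    (q : Submodule K W) (p : Submodule K V) :
    finrank K (boundedMaps q p) ≤ finrank K (W ⧸ q) * finrank K p := by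
  let F : (W ⧸ q →ₗ[K] p) →ₗ[K] (W →ₗ[K] V) :=
    (LinearMap.compRight K p.subtype).comp (LinearMap.lcomp K p q.mkQ)
  have hle : boundedMaps q p ≤ LinearMap.range F := by
    rintro Y ⟨h0, hp⟩
    refine ⟨q.liftQ (Y.codRestrict p hp) fun w hw => ?_, ?_⟩
    · ext; simp [h0 w hw]
    · ext w; rfl
  calc _ ≤ finrank K (LinearMap.range F) := Submodule.finrank_mono hle
    _ ≤ finrank K (W ⧸ q →ₗ[K] p) := LinearMap.finrank_range_le F
    _ = _ := finrank_linearMap ..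

/-- The action `X ↦ A X B⁻¹` of `GL(V) × GL(W)` on `Hom(W, V)`. -/
def LinearMap.homAction (K V W : Type*) [Field K] [AddCommGroup V] [Module K V]
    [AddCommGroup W] [Module K W] :
    (End K V)ˣ × (End K W)ˣ →* End K (W →ₗ[K] V) where
  toFun g := (LinearMap.compRight K (g.1 : End K V)).comp
    (LinearMap.lcomp K V ((g.2⁻¹ : (End K W)ˣ) : End K W))
  map_one' := by ext; simp
  map_mul' g h := by ext; simp

theorem LinearMap.homAction_apply {K V W : Type*} [Field K] [AddCommGroup V] [Module K V]
    [AddCommGroup W] [Module K W] (g : (End K V)ˣ × (End K W)ˣ) (X : W →ₗ[K] V) (w : W) :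
    homAction K V W g X w = (g.1 : End K V) (X ((g.2⁻¹ : (End K W)ˣ).1 w)) := rfl

theorem finrank_range_homAction_sub_one_le {K V W : Type*} [Field K] [AddCommGroup V] [Module K V]
    [AddCommGroup W] [Module K W] [FiniteDimensional K V] [FiniteDimensional K W]
    (A : (End K V)ˣ) (B : (End K W)ˣ) :
    finrank K (LinearMap.range (1 - LinearMap.homAction K V W (A, B))) ≤
      finrank K W * finrank K (LinearMap.range (1 - (A : End K V))) +
      finrank K (LinearMap.range (1 - (B : End K W))) * finrank K V := by
  have hle : LinearMap.range (1 - LinearMap.homAction K V W (A, B)) ≤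
      LinearMap.boundedMaps ⊥ (LinearMap.range (1 - (A : End K V))) ⊔
      LinearMap.boundedMaps (LinearMap.ker (1 - (B : End K W))) ⊤ := by
    rintro _ ⟨X, rfl⟩
    let C : End K W := ((B⁻¹ : (End K W)ˣ) : End K W)
    have hC : ∀ w, C ((B : End K W) w) = w := fun w => LinearMap.congr_fun B.inv_mul w
    -- Telescoping, with `C = B⁻¹`: X - AXC = (1 - A)XC + X(1 - C).
    refine Submodule.mem_sup.2 ⟨(1 - (A : End K V)) ∘ₗ X ∘ₗ C, ⟨?_, ?_⟩,
      X ∘ₗ (1 - C), ⟨?_, ?_⟩, ?_⟩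
    · simp
    · intro w; exact ⟨_, rfl⟩
    · intro w hw
      have hw' : w = (B : End K W) w := sub_eq_zero.1 (by simpa using hw)
      have : C w = w := by conv_lhs => rw [hw', hC]
      simp [this]
    · simp
    · ext w
      simp [LinearMap.homAction_apply, C]
  refine (Submodule.finrank_mono hle).trans ((Submodule.finrank_add_le_finrank_add_finrank _ _).trans
    (add_le_add ((LinearMap.finrank_boundedMaps_le _ _).trans_eq ?_)
      ((LinearMap.finrank_boundedMaps_le _ _).trans_eq ?_)))
  · rw [(Submodule.quotEquivOfEqBot (⊥ : Submodule K W) rfl).finrank_eq]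
  · rw [(LinearMap.quotKerEquivRange (1 - (B : End K W))).finrank_eq, finrank_top]

/-- A fixed `X` satisfies AX = XB, hence RX = XS with R = 1 - A and S = 1 - B. The map X ↦ RX has
image among maps killing ker S with values in range R; its kernel consists of maps killing range S
with values in ker R. -/
theorem finrank_ker_homAction_sub_one_le {K V W : Type*} [Field K] [AddCommGroup V] [Module K V]
    [AddCommGroup W] [Module K W] [FiniteDimensional K V] [FiniteDimensional K W]
    (A : (End K V)ˣ) (B : (End K W)ˣ) :
    finrank K (LinearMap.ker (1 - LinearMap.homAction K V W (A, B))) ≤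
      finrank K (LinearMap.range (1 - (B : End K W))) *
        finrank K (LinearMap.range (1 - (A : End K V))) +
      finrank K (LinearMap.ker (1 - (B : End K W))) *
        finrank K (LinearMap.ker (1 - (A : End K V))) := by
  set R : End K V := 1 - (A : End K V) with hR
  set S : End K W := 1 - (B : End K W) with hS
  have hfix : ∀ X ∈ LinearMap.ker (1 - LinearMap.homAction K V W (A, B)),
      ∀ w, R (X w) = X (S w) := by
    intro X hX w
    have h1 : LinearMap.homAction K V W (A, B) X = X := (sub_eq_zero.1 (by simpa using hX)).symm
    have h2 : (A : End K V) (X w) = X ((B : End K W) w) := by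
      conv_rhs => rw [← h1, LinearMap.homAction_apply]
      exact congrArg (fun u => (A : End K V) (X u)) (LinearMap.congr_fun B.inv_mul w).symm
    simp [hR, hS, h2]
  let F : LinearMap.ker (1 - LinearMap.homAction K V W (A, B)) →ₗ[K] (W →ₗ[K] V) :=
    (LinearMap.compRight K R).comp (Submodule.subtype _)
  rw [← LinearMap.finrank_range_add_finrank_ker F]
  refine add_le_add ?_ ?_
  · have hle : LinearMap.range F ≤ LinearMap.boundedMaps (LinearMap.ker S) (LinearMap.range R) := by
      rintro _ ⟨X, rfl⟩
      refine ⟨fun w hw => ?_, fun w => ⟨_, rfl⟩⟩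
      change R (X.1 w) = 0
      rw [hfix X.1 X.2, LinearMap.mem_ker.1 hw, map_zero]
    refine (Submodule.finrank_mono hle).trans ((LinearMap.finrank_boundedMaps_le _ _).trans_eq ?_)
    rw [(LinearMap.quotKerEquivRange S).finrank_eq]
  · have hle : (LinearMap.ker F).map (Submodule.subtype _) ≤
        LinearMap.boundedMaps (LinearMap.range S) (LinearMap.ker R) := by
      rintro _ ⟨X, hX, rfl⟩
      have h0 : ∀ w, R (X.1 w) = 0 := fun w => LinearMap.congr_fun (LinearMap.mem_ker.1 hX) w
      refine ⟨?_, h0⟩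
      rintro _ ⟨w, rfl⟩
      exact (hfix X.1 X.2 w).symm.trans (h0 w)
    rw [(Submodule.equivMapOfInjective _ (Submodule.subtype_injective _)
      (LinearMap.ker F)).finrank_eq]
    refine (Submodule.finrank_mono hle).trans ((LinearMap.finrank_boundedMaps_le _ _).trans_eq ?_)
    congr 1
    have h1 := Submodule.finrank_quotient_add_finrank (LinearMap.range S)
    have h2 := LinearMap.finrank_range_add_finrank_ker S
    omega

theorem finrank_range_prodMap {K V W : Type*} [Field K] [AddCommGroup V] [Module K V]
    [AddCommGroup W] [Module K W] [FiniteDimensional K V] [FiniteDimensional K W]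
    (f : End K V) (g : End K W) :
    finrank K (LinearMap.range (f.prodMap g)) =
      finrank K (LinearMap.range f) + finrank K (LinearMap.range g) := by
  let J := (LinearMap.range f).subtype.prodMap (LinearMap.range g).subtype
  have hJ : Function.Injective J :=
    Function.Injective.prodMap (Submodule.subtype_injective _) (Submodule.subtype_injective _)
  have hr : LinearMap.range (f.prodMap g) = LinearMap.range J := by
    ext ⟨v, w⟩
    constructor
    · rintro ⟨⟨a, b⟩, h⟩
      exact ⟨(⟨f a, a, rfl⟩, ⟨g b, b, rfl⟩), h⟩
    · rintro ⟨⟨⟨_, a, rfl⟩, ⟨_, b, rfl⟩⟩, h⟩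
      exact ⟨(a, b), h⟩
  rw [hr, LinearMap.finrank_range_of_inj hJ, finrank_prod]

/-! ### Rank length and homomorphisms between general linear groups -/

theorem rankLength_le_one {K : Type*} [Field K] {n : ℕ} (A : Matrix.GeneralLinearGroup (Fin n) K) :
    rankLength A ≤ 1 := by
  refine div_le_one_of_le₀ ?_ (Nat.cast_nonneg n)
  exact_mod_cast (Matrix.rank_le_width _)

theorem rankLength_nonneg {K : Type*} [Field K] {n : ℕ}
    (A : Matrix.GeneralLinearGroup (Fin n) K) : 0 ≤ rankLength A := by
  unfold rankLength; positivity

theorem rankLength_one {K : Type*} [Field K] {n : ℕ} :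
    rankLength (1 : Matrix.GeneralLinearGroup (Fin n) K) = 0 := by
  simp [rankLength]

/-- The relative rank of `1 - f` for an endomorphism `f`. -/
noncomputable def Module.End.rankLength {K V : Type*} [Field K] [AddCommGroup V] [Module K V]
    (f : End K V) : ℝ :=
  (finrank K (LinearMap.range (1 - f)) : ℝ) / finrank K V

/-- Invertible endomorphisms of a vector space with a finite basis as invertible matrices. -/
noncomputable def unitsEndEquivGL {K V : Type*} [Field K] [AddCommGroup V] [Module K V] {n : ℕ}
    (b : Basis (Fin n) K V) : (End K V)ˣ ≃* Matrix.GeneralLinearGroup (Fin n) K :=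
  Units.mapEquiv (LinearMap.toMatrixAlgEquiv b).toMulEquiv

theorem rankLength_unitsEndEquivGL {K V : Type*} [Field K] [AddCommGroup V] [Module K V] {n : ℕ}
    (b : Basis (Fin n) K V) (f : (End K V)ˣ) :
    rankLength (unitsEndEquivGL b f) = (f : End K V).rankLength := by
  have h : (1 - (unitsEndEquivGL b f : Matrix (Fin n) (Fin n) K)) =
      LinearMap.toMatrix b b (1 - (f : End K V)) := by
    rw [map_sub]
    change _ = LinearMap.toMatrix b b LinearMap.id - _
    rw [LinearMap.toMatrix_id]
    rfl
  rw [rankLength, Module.End.rankLength, h, Matrix.rank_eq_finrank_range_toLin _ b b,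
    Matrix.toLin_toMatrix, finrank_eq_card_basis b, Fintype.card_fin]

theorem rankLength_unitsEndEquivGL_symm {K V : Type*} [Field K] [AddCommGroup V] [Module K V]
    {n : ℕ} (b : Basis (Fin n) K V) (A : Matrix.GeneralLinearGroup (Fin n) K) :
    (((unitsEndEquivGL b).symm A : (End K V)ˣ) : End K V).rankLength = rankLength A := by
  rw [← rankLength_unitsEndEquivGL b, MulEquiv.apply_symm_apply]

/-- A linear representation of `G` on a nonzero finite-dimensional space is equivalent, with the
same rank lengths, to a matrix representation. -/
theorem exists_monoidHom_rankLength_eq {K V G : Type*} [Field K] [AddCommGroup V] [Module K V]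
    [FiniteDimensional K V] [Nontrivial V] [Group G] (ρ : G →* End K V) :
    ∃ (N : ℕ+) (Φ : G →* Matrix.GeneralLinearGroup (Fin N) K),
      ∀ g, rankLength (Φ g) = (ρ g).rankLength :=
  ⟨⟨finrank K V, finrank_pos⟩,
    (unitsEndEquivGL (finBasis K V)).toMonoidHom.comp ρ.toHomUnits,
    fun _ => rankLength_unitsEndEquivGL _ _⟩

theorem exists_tensor_monoidHom (K : Type*) [Field K] (n m : ℕ+) :
    ∃ (N : ℕ+) (Φ : Matrix.GeneralLinearGroup (Fin n) K × Matrix.GeneralLinearGroup (Fin m) K →*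
        Matrix.GeneralLinearGroup (Fin N) K), ∀ A B,
      rankLength (Φ (A, B)) ≤ rankLength A + rankLength B ∧
      1 - 2 * rankLength (Φ (A, B)) ≤ (1 - 2 * rankLength A) * (1 - 2 * rankLength B) := by
  let V := Fin n → K
  let W := Fin m → K
  let eV := unitsEndEquivGL (Pi.basisFun K (Fin n))
  let eW := unitsEndEquivGL (Pi.basisFun K (Fin m))
  have : Nonempty (Fin n) := ⟨⟨0, n.pos⟩⟩
  have : Nonempty (Fin m) := ⟨⟨0, m.pos⟩⟩
  obtain ⟨N, Φ, hΦ⟩ := exists_monoidHom_rankLength_eq ((LinearMap.homAction K V W).comp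
    (eV.symm.toMonoidHom.prodMap eW.symm.toMonoidHom))
  refine ⟨N, Φ, fun A B => ?_⟩
  rw [hΦ, ← rankLength_unitsEndEquivGL_symm (Pi.basisFun K (Fin n)) A,
    ← rankLength_unitsEndEquivGL_symm (Pi.basisFun K (Fin m)) B]
  change End.rankLength (LinearMap.homAction K V W (eV.symm A, eW.symm B)) ≤
    End.rankLength (eV.symm A : End K V) + End.rankLength (eW.symm B : End K W) ∧
    1 - 2 * End.rankLength (LinearMap.homAction K V W (eV.symm A, eW.symm B)) ≤
      (1 - 2 * End.rankLength (eV.symm A : End K V)) *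
        (1 - 2 * End.rankLength (eW.symm B : End K W))
  generalize eV.symm A = f
  generalize eW.symm B = g
  have hup := finrank_range_homAction_sub_one_le f g
  have hlo := finrank_ker_homAction_sub_one_le f g
  have hH := LinearMap.finrank_range_add_finrank_ker (1 - LinearMap.homAction K V W (f, g))
  have hf := LinearMap.finrank_range_add_finrank_ker (1 - (f : End K V))
  have hg := LinearMap.finrank_range_add_finrank_ker (1 - (g : End K W))
  rw [finrank_linearMap] at hH
  have hn : (0 : ℝ) < finrank K V := by exact_mod_cast finrank_pos
  have hm : (0 : ℝ) < finrank K W := by exact_mod_cast finrank_pos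
  simp only [End.rankLength, finrank_linearMap]
  generalize finrank K (LinearMap.range (1 - LinearMap.homAction K V W (f, g))) = t at *
  generalize finrank K (LinearMap.ker (1 - LinearMap.homAction K V W (f, g))) = t' at *
  generalize finrank K (LinearMap.range (1 - (f : End K V))) = r at *
  generalize finrank K (LinearMap.ker (1 - (f : End K V))) = r' at *
  generalize finrank K (LinearMap.range (1 - (g : End K W))) = s at *
  generalize finrank K (LinearMap.ker (1 - (g : End K W))) = s' at *
  generalize finrank K V = a at *
  generalize finrank K W = b at *
  have hup' : (t : ℝ) ≤ b * r + s * a := by exact_mod_cast hup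
  have hlo' : (t' : ℝ) ≤ s * r + s' * r' := by exact_mod_cast hlo
  have hH' : (t : ℝ) + t' = b * a := by exact_mod_cast hH
  have hf' : (r : ℝ) + r' = a := by exact_mod_cast hf
  have hg' : (s : ℝ) + s' = b := by exact_mod_cast hg
  push_cast
  constructor
  · rw [div_add_div _ _ hn.ne' hm.ne', div_le_div_iff₀ (by positivity) (by positivity)]
    nlinarith [mul_le_mul_of_nonneg_right hup' (mul_pos hn hm).le]
  -- Since t = ba - t', the bound t' ≤ sr + (b - s)(a - r) rearranges exactly to this product.
  · have key : (b * a : ℝ) - 2 * t ≤ (a - 2 * r) * (b - 2 * s) := by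
      have h1 : (r' : ℝ) = a - r := by linarith
      have h2 : (s' : ℝ) = b - s := by linarith
      rw [h1, h2] at hlo'
      nlinarith
    have e1 : (1 : ℝ) - 2 * (t / (b * a)) = (b * a - 2 * t) / (b * a) := by field_simp
    have e2 : ((1 : ℝ) - 2 * (r / a)) * (1 - 2 * (s / b)) =
        ((a - 2 * r) * (b - 2 * s)) / (b * a) := by field_simp
    rw [e1, e2]
    gcongr

theorem exists_blockSum_monoidHom (K : Type*) [Field K] (n : ℕ+) :
    ∃ (N : ℕ+) (Φ : Matrix.GeneralLinearGroup (Fin n) K × Matrix.GeneralLinearGroup (Fin n) K →*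
        Matrix.GeneralLinearGroup (Fin N) K), ∀ A B,
      rankLength (Φ (A, B)) = (rankLength A + rankLength B) / 2 := by
  let V := Fin n → K
  let e := unitsEndEquivGL (Pi.basisFun K (Fin n))
  have : Nonempty (Fin n) := ⟨⟨0, n.pos⟩⟩
  let P : (End K V)ˣ × (End K V)ˣ →* End K (V × V) :=
    { toFun := fun g => (g.1 : End K V).prodMap (g.2 : End K V)
      map_one' := rfl
      map_mul' := fun _ _ => rfl }
  obtain ⟨N, Φ, hΦ⟩ := exists_monoidHom_rankLength_eq
    (P.comp (e.symm.toMonoidHom.prodMap e.symm.toMonoidHom))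
  refine ⟨N, Φ, fun A B => ?_⟩
  rw [hΦ, ← rankLength_unitsEndEquivGL_symm (Pi.basisFun K (Fin n)) A,
    ← rankLength_unitsEndEquivGL_symm (Pi.basisFun K (Fin n)) B]
  change End.rankLength ((e.symm A : End K V).prodMap (e.symm B : End K V)) =
    (End.rankLength (e.symm A : End K V) + End.rankLength (e.symm B : End K V)) / 2
  have hsub : (1 : End K (V × V)) - (e.symm A : End K V).prodMap (e.symm B : End K V) =
      (1 - (e.symm A : End K V)).prodMap (1 - (e.symm B : End K V)) := rfl
  have hn : (0 : ℝ) < finrank K V := by exact_mod_cast finrank_pos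
  rw [End.rankLength, End.rankLength, End.rankLength, hsub, finrank_range_prodMap, finrank_prod]
  push_cast
  field_simp
  ring

/-- Direct sum of suitable multiples, to make the two summands have equal dimension. -/
theorem exists_balancedSum_monoidHom (K : Type*) [Field K] (n m : ℕ+) :
    ∃ (N : ℕ+) (Φ : Matrix.GeneralLinearGroup (Fin n) K × Matrix.GeneralLinearGroup (Fin m) K →*
        Matrix.GeneralLinearGroup (Fin N) K), ∀ A B,
      rankLength (Φ (A, B)) = (rankLength A + rankLength B) / 2 := by
  obtain ⟨k, T, hT⟩ := exists_tensor_monoidHom K n m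
  obtain ⟨N, D, hD⟩ := exists_blockSum_monoidHom K k
  refine ⟨N, D.comp ((T.comp ((MonoidHom.inl _ _).comp (MonoidHom.fst _ _))).prod
    (T.comp ((MonoidHom.inr _ _).comp (MonoidHom.snd _ _)))), fun A B => ?_⟩
  -- Pairing with 1 preserves rank length: the two tensor estimates then bound it from both sides.
  have h1 := hT A 1
  have h2 := hT 1 B
  rw [rankLength_one] at h1 h2
  change rankLength (D (T (A, 1), T (1, B))) = _
  rw [hD]
  linarith [h1.1, h1.2, h2.1, h2.2]

/-- The functor `A ↦ (A ⊕ 1)^{⊗ k}` brings the rank length of every element that is not too close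
to the identity arbitrarily near to `1 / 2`. -/
theorem exists_amplification_monoidHom (K : Type*) [Field K] (n : ℕ+) (k : ℕ) :
    ∃ (N : ℕ+) (Φ : Matrix.GeneralLinearGroup (Fin n) K →* Matrix.GeneralLinearGroup (Fin N) K),
      ∀ A, rankLength (Φ A) ≤ k * rankLength A ∧
        1 - 2 * rankLength (Φ A) ≤ (1 - rankLength A) ^ k := by
  induction k with
  | zero =>
    refine ⟨1, 1, fun A => ?_⟩
    rw [MonoidHom.one_apply, rankLength_one]
    simp
  | succ k ih =>
    obtain ⟨N, Φ, hΦ⟩ := ih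
    obtain ⟨M, D, hD⟩ := exists_blockSum_monoidHom K n
    obtain ⟨L, T, hT⟩ := exists_tensor_monoidHom K N M
    refine ⟨L, T.comp (Φ.prod (D.comp (MonoidHom.inl _ _))), fun A => ?_⟩
    have h := hT (Φ A) (D (A, 1))
    rw [hD, rankLength_one] at h
    change rankLength (T (Φ A, D (A, 1))) ≤ _ ∧ 1 - 2 * rankLength (T (Φ A, D (A, 1))) ≤ _
    have h0 := rankLength_nonneg A
    have h1 := rankLength_le_one A
    obtain ⟨hu, hl⟩ := hΦ A
    constructor
    · push_cast
      linarith [h.1]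
    · rw [pow_succ]
      have : 1 - 2 * ((rankLength A + 0) / 2) = 1 - rankLength A := by ring
      rw [this] at h
      exact h.2.trans (mul_le_mul_of_nonneg_right hl (by linarith))

/-! ### Separation with a uniform constant -/

/-- Almost homomorphisms `Γ → GL_n(K)` of arbitrary precision exist for which all elements of `S`
have rank length at least `δ`. -/
def SeparatesWith (K : Type*) [Field K] {Γ : Type*} [Group Γ] (δ : ℝ) (S : Set Γ) : Prop :=
  ∀ ε : ℝ, 0 < ε → ∀ E : Finset Γ, ∃ (n : ℕ+) (φ : Γ → Matrix.GeneralLinearGroup (Fin n) K),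
    rankLength (φ 1) ≤ ε ∧ (∀ g ∈ S, δ ≤ rankLength (φ g)) ∧
    ∀ g ∈ E, ∀ h ∈ E, rankLength (φ g * φ h * (φ (g * h))⁻¹) ≤ ε

theorem SeparatesWith.union {K Γ : Type*} [Field K] [Group Γ] {δ₁ δ₂ : ℝ} {S₁ S₂ : Set Γ}
    (h₁ : SeparatesWith K δ₁ S₁) (h₂ : SeparatesWith K δ₂ S₂) :
    SeparatesWith K (min δ₁ δ₂ / 2) (S₁ ∪ S₂) := by
  intro ε hε E
  obtain ⟨n, φ, hφ1, hφS, hφE⟩ := h₁ ε hε E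
  obtain ⟨m, ψ, hψ1, hψS, hψE⟩ := h₂ ε hε E
  obtain ⟨N, D, hD⟩ := exists_balancedSum_monoidHom K n m
  refine ⟨N, fun g => D (φ g, ψ g), ?_, ?_, fun g hg h hh => ?_⟩
  · rw [hD]; linarith
  · intro g hg
    rw [hD]
    have h1 := rankLength_nonneg (φ g)
    have h2 := rankLength_nonneg (ψ g)
    have h3 := min_le_left δ₁ δ₂
    have h4 := min_le_right δ₁ δ₂
    rcases hg with hg | hg
    · linarith [hφS g hg]
    · linarith [hψS g hg]
  · rw [← map_mul, ← map_inv, ← map_mul]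
    change rankLength (D (φ g * φ h * (φ (g * h))⁻¹, ψ g * ψ h * (ψ (g * h))⁻¹)) ≤ ε
    rw [hD]
    linarith [hφE g hg h hh, hψE g hg h hh]

theorem SeparatesWith.comap {K Γ Γ' : Type*} [Field K] [Group Γ] [Group Γ'] {δ : ℝ} {S : Set Γ'}
    (h : SeparatesWith K δ S) (f : Γ →* Γ') : SeparatesWith K δ (f ⁻¹' S) := by
  classical
  intro ε hε E
  obtain ⟨n, φ, hφ1, hφS, hφE⟩ := h ε hε (E.image f)
  refine ⟨n, φ ∘ f, by simpa using hφ1, fun g hg => hφS _ hg, fun g hg k hk => ?_⟩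
  simpa using hφE (f g) (Finset.mem_image_of_mem f hg) (f k) (Finset.mem_image_of_mem f hk)

theorem SeparatesWith.amplify {K Γ : Type*} [Field K] [Group Γ] {δ : ℝ} {S : Set Γ}
    (hδ : 0 < δ) (h : SeparatesWith K δ S) : SeparatesWith K (1 / 4) S := by
  -- This `k` forces 1 - 2ℓ < 1/2 after amplification, that is ℓ > 1/4.
  obtain ⟨k, hk⟩ : ∃ k : ℕ, (max 0 (1 - δ)) ^ k < 1 / 2 :=
    exists_pow_lt_of_lt_one (by norm_num) (max_lt one_pos (by linarith))
  intro ε hε E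
  have hk0 : (0 : ℝ) < k + 1 := by positivity
  -- Amplification multiplies errors by at most `k`; `k + 1` also covers k = 0.
  obtain ⟨n, φ, hφ1, hφS, hφE⟩ := h (ε / (k + 1)) (by positivity) E
  obtain ⟨N, Φ, hΦ⟩ := exists_amplification_monoidHom K n k
  have hsmall : ∀ A : Matrix.GeneralLinearGroup (Fin n) K,
      rankLength A ≤ ε / (k + 1) → rankLength (Φ A) ≤ ε := by
    intro A hA
    rw [le_div_iff₀ hk0] at hA
    linarith [(hΦ A).1, rankLength_nonneg A]
  refine ⟨N, Φ ∘ φ, hsmall _ hφ1, fun g hg => ?_, fun g hg k hk => ?_⟩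
  · have h1 : (1 - rankLength (φ g)) ^ k ≤ (max 0 (1 - δ)) ^ k :=
      pow_le_pow_left₀ (by linarith [rankLength_le_one (φ g)])
        (le_max_of_le_right (by linarith [hφS g hg])) k
    have h2 := (hΦ (φ g)).2
    simp only [Function.comp_apply]
    linarith
  · simp only [Function.comp_apply, ← map_mul, ← map_inv]
    exact hsmall _ (hφE g hg k hk)

theorem IsSoficOver.separatesWith_singleton {K Γ : Type*} [Field K] [Group Γ]
    (h : IsSoficOver K Γ) {g : Γ} (hg : g ≠ 1) : SeparatesWith K (1 / 4) {g} := by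
  classical
  obtain ⟨δ, hδ, h⟩ := h
  refine SeparatesWith.amplify (hδ g hg) fun ε hε E => ?_
  obtain ⟨n, φ, h1, hS, hE⟩ := h ε hε (insert g E)
  refine ⟨n, φ, h1, ?_, fun a ha b hb =>
    hE a (Finset.mem_insert_of_mem ha) b (Finset.mem_insert_of_mem hb)⟩
  rintro _ rfl
  exact hS _ (Finset.mem_insert_self _ _) hg

theorem separatesWith_finset {K Γ : Type*} [Field K] [Group Γ]
    (h : ∀ g : Γ, g ≠ 1 → SeparatesWith K (1 / 4) {g}) (S : Finset Γ) (hS : 1 ∉ S) :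
    SeparatesWith K (1 / 4) (S : Set Γ) := by
  classical
  induction S using Finset.induction_on with
  | empty =>
    intro ε hε E
    refine ⟨1, fun _ => 1, rankLength_one.trans_le hε.le, by simp, fun g _ k _ => ?_⟩
    rw [one_mul, one_mul, inv_one]
    exact rankLength_one.trans_le hε.le
  | insert a s ha ih =>
    rw [Finset.mem_insert, not_or] at hS
    rw [Finset.coe_insert, Set.insert_eq]
    -- The union only gives 1/8; amplifying restores 1/4, so the constant does not decay with the
    -- size of the set.
    exact ((h a (Ne.symm hS.1)).union (ih hS.2)).amplify (by norm_num)

theorem isSoficOver_iff_separatesWith_singleton {K Γ : Type*} [Field K] [Group Γ] :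
    IsSoficOver K Γ ↔ ∀ g : Γ, g ≠ 1 → SeparatesWith K (1 / 4) {g} := by
  classical
  refine ⟨fun h g hg => h.separatesWith_singleton hg, fun h => ?_⟩
  refine ⟨fun _ => 1 / 4, fun _ _ => by norm_num, fun ε hε E => ?_⟩
  obtain ⟨n, φ, h1, hS, hE⟩ := separatesWith_finset h (E.erase 1) (by simp) ε hε E
  exact ⟨n, φ, h1, fun g hg hg1 => hS g (by simp [hg, hg1]), hE⟩

/-! ### Closure properties -/

/-- Homomorphisms to `K`-sofic groups that jointly separate points from `1` ensure `K`-soficity. -/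
theorem isSoficOver_of_separating {K Γ : Type*} [Field K] [Group Γ] {ι : Type*} {Λ : ι → Type*}
    [∀ i, Group (Λ i)] (hΛ : ∀ i, IsSoficOver K (Λ i)) (f : ∀ i, Γ →* Λ i)
    (hf : ∀ g : Γ, g ≠ 1 → ∃ i, f i g ≠ 1) : IsSoficOver K Γ := by
  refine isSoficOver_iff_separatesWith_singleton.2 fun g hg => ?_
  obtain ⟨i, hi⟩ := hf g hg
  intro ε hε E
  obtain ⟨n, φ, h1, hS, hE⟩ := ((hΛ i).separatesWith_singleton hi).comap (f i) ε hε E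
  refine ⟨n, φ, h1, ?_, hE⟩
  rintro _ rfl
  exact hS _ rfl

theorem IsSoficOver.subgroup {K Γ : Type*} [Field K] [Group Γ] (h : IsSoficOver K Γ)
    (H : Subgroup Γ) : IsSoficOver K H :=
  isSoficOver_of_separating (fun _ : Unit => h) (fun _ => H.subtype)
    fun _ hg => ⟨(), fun h1 => hg (Subtype.ext h1)⟩

theorem IsSoficOver.pi {K ι : Type*} [Field K] {Γ : ι → Type*} [∀ i, Group (Γ i)]
    (h : ∀ i, IsSoficOver K (Γ i)) : IsSoficOver K (∀ i, Γ i) :=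
  isSoficOver_of_separating h (fun i => Pi.evalMonoidHom Γ i) fun _ hg => Function.ne_iff.1 hg

/-- A representative at level `i` of an element of a direct limit; it is meaningful once `i` is
large enough. -/
noncomputable def DirectLimit.levelRep {ι : Type*} [Preorder ι] [IsDirectedOrder ι]
    {Γ : ι → Type*} [∀ i, Group (Γ i)] (f : ∀ i j, i ≤ j → Γ i →* Γ j)
    [DirectedSystem Γ (fun i j h => ⇑(f i j h))] (i : ι) (z : DirectLimit Γ f) : Γ i :=
  open Classical in if h : z.out.1 ≤ i then f _ i h z.out.2 else 1

section

variable {ι : Type*} [Preorder ι] [IsDirectedOrder ι] {Γ : ι → Type*} [∀ i, Group (Γ i)]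
  (f : ∀ i j, i ≤ j → Γ i →* Γ j) [DirectedSystem Γ (fun i j h => ⇑(f i j h))]

theorem DirectLimit.mk_levelRep {i : ι} {z : DirectLimit Γ f} (h : z.out.1 ≤ i) :
    (⟦⟨i, levelRep f i z⟩⟧ : DirectLimit Γ f) = z := by
  rw [levelRep, dif_pos h, DirectLimit.mk_apply]
  exact Quotient.out_eq z

theorem DirectLimit.map_levelRep {i j : ι} (hij : i ≤ j) {z : DirectLimit Γ f}
    (h : z.out.1 ≤ i) : f i j hij (levelRep f i z) = levelRep f j z := by
  rw [levelRep, levelRep, dif_pos h, dif_pos (h.trans hij)]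
  exact DirectedSystem.map_map' f h hij _

/-- The two sides represent the same element of the limit, so they agree from some level on, even if
the connecting maps are not injective. -/
theorem DirectLimit.eventually_levelRep_mul (z w : DirectLimit Γ f) :
    ∀ᶠ i in Filter.atTop, levelRep f i z * levelRep f i w = levelRep f i (z * w) := by
  obtain ⟨k, hz, hw, hzw⟩ := directed_of₃ (· ≤ ·) z.out.1 w.out.1 (z * w).out.1
  have heq : (⟦⟨k, levelRep f k z * levelRep f k w⟩⟧ : DirectLimit Γ f) =
      ⟦⟨k, levelRep f k (z * w)⟩⟧ := by
    rw [← DirectLimit.mul_def, mk_levelRep f hz, mk_levelRep f hw, mk_levelRep f hzw]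
  obtain ⟨j, hj, hj', h⟩ := Quotient.exact heq
  filter_upwards [Filter.eventually_ge_atTop j] with i hi
  have hki : k ≤ i := hj.trans hi
  have h' := congrArg (f j i hi) h
  change f j i hi (f k j hj (levelRep f k z * levelRep f k w)) =
    f j i hi (f k j hj' (levelRep f k (z * w))) at h'
  rw [DirectedSystem.map_map' f, DirectedSystem.map_map' f, map_mul, map_levelRep f _ hz,
    map_levelRep f _ hw, map_levelRep f _ hzw] at h'
  exact h'

theorem DirectLimit.eventually_levelRep_ne_one [Nonempty ι] {z : DirectLimit Γ f} (hz : z ≠ 1) :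
    ∀ᶠ i in Filter.atTop, levelRep f i z ≠ 1 := by
  filter_upwards [Filter.eventually_ge_atTop z.out.1] with i hi h
  exact hz (by rw [← mk_levelRep f hi, h, ← DirectLimit.one_def])

end

theorem IsSoficOver.directLimit {K ι : Type*} [Field K] [Preorder ι] [IsDirectedOrder ι]
    [Nonempty ι] {Γ : ι → Type*} [∀ i, Group (Γ i)] (f : ∀ i j, i ≤ j → Γ i →* Γ j)
    [DirectedSystem Γ (fun i j h => ⇑(f i j h))] (hΓ : ∀ i, IsSoficOver K (Γ i)) :
    IsSoficOver K (DirectLimit Γ f) := by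
  classical
  refine isSoficOver_iff_separatesWith_singleton.2 fun z hz ε hε E => ?_
  have hmul : ∀ᶠ i in Filter.atTop, ∀ a ∈ E, ∀ b ∈ E, DirectLimit.levelRep f i a *
      DirectLimit.levelRep f i b = DirectLimit.levelRep f i (a * b) :=
    (Filter.eventually_all_finset E).2 fun a _ => (Filter.eventually_all_finset E).2 fun b _ =>
      DirectLimit.eventually_levelRep_mul f a b
  -- The relation 1 * 1 = 1 is included to make the representative of 1 trivial at level `i`.
  obtain ⟨i, hm, h1, hne⟩ := (hmul.and ((DirectLimit.eventually_levelRep_mul f 1 1).and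
    (DirectLimit.eventually_levelRep_ne_one f hz))).exists
  rw [mul_one, mul_eq_left] at h1
  obtain ⟨n, φ, hφ1, hφS, hφE⟩ := (hΓ i).separatesWith_singleton hne ε hε
    (E.image (DirectLimit.levelRep f i))
  refine ⟨n, fun g => φ (DirectLimit.levelRep f i g), by simpa only [h1] using hφ1, ?_, fun a ha b hb => ?_⟩
  · rintro _ rfl
    exact hφS _ rfl
  · simp only [← hm a ha b hb]
    exact hφE _ (Finset.mem_image_of_mem _ ha) _ (Finset.mem_image_of_mem _ hb)

theorem mainTheorem7 (K : Type*) [Field K] :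
    -- subgroups
    (∀ (Γ : Type*) [Group Γ], IsSoficOver K Γ → ∀ H : Subgroup Γ, IsSoficOver K H) ∧
    -- inverse limits
    (∀ (ι : Type*) [Preorder ι] [IsDirectedOrder ι] (Γ : ι → Type*) [∀ i, Group (Γ i)]
      (π : ∀ i j, i ≤ j → Γ j →* Γ i) [InverseSystem (fun i j h => ⇑(π i j h))],
      (∀ i, IsSoficOver K (Γ i)) → IsSoficOver K (inverseLimitSubgroup Γ π)) ∧
    -- direct products
    (∀ (ι : Type*) (Γ : ι → Type*) [∀ i, Group (Γ i)],
      (∀ i, IsSoficOver K (Γ i)) → IsSoficOver K (∀ i, Γ i)) ∧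
    -- direct limits
    (∀ (ι : Type*) [Preorder ι] [IsDirectedOrder ι] [Nonempty ι] (Γ : ι → Type*)
      [∀ i, Group (Γ i)] (f : ∀ i j, i ≤ j → Γ i →* Γ j)
      [DirectedSystem Γ (fun i j h => ⇑(f i j h))],
      (∀ i, IsSoficOver K (Γ i)) → IsSoficOver K (DirectLimit Γ f)) := by
  exact ⟨fun _ _ h H => h.subgroup H, fun _ _ _ _ _ _ _ h => (IsSoficOver.pi h).subgroup _,
    fun _ _ _ h => IsSoficOver.pi h, fun _ _ _ _ _ _ f _ h => IsSoficOver.directLimit f h⟩
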